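/- Let $K$ be a compact Hausdorff space and let $X$ be a complex Banach space with a locally convex Hausdorff vector space topology $\tau$ that is compatible to a dual pair, i.e. $(X,\tau)^*=X^*$ or $(X,\tau)^*=X_*$ for a predual $X_*$ of $X$ (a Banach space whose dual is isometrically $X$). Let $C(K,(X,\tau))$ be the Banach space of all continuous functions $f:K\to(X,\tau)$ with the norm $\|f\|=\sup_{t\in K}\|f(t)\|_X$. Let $A(K,(X,\tau))$ be an $(X,\tau)$-valued function space over a uniform algebra $A$ on $K$, that is, a closed subspace of $C(K,(X,\tau))$ such that (i) the base algebra $A=\{y^*\circ f : f\in A(K,(X,\tau)),\ y^*\in (X,\tau)^*\}$ is a uniform algebra on $K$ (a closed subalgebra of $C(K)=C(K,\mathbb C)$ that contains the constants and separates the points of $K$); (ii) $\phi f\in A(K,(X,\tau))$ for all $\phi\in A$ and $f\in A(K,(X,\tau))$. Assume that $A\otimes X\subset A(K,(X,\tau))$, i.e. every function $t\mapsto\phi(t)x$ with $\phi\in A$, $x\in X$ belongs to $A(K,(X,\tau))$. Let $\Gamma$ be the Shilov boundary of $A$, i.e. the smallest closed subset of $K$ on which every $\phi\in A$ attains its supremum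 norm (equivalently, the intersection of all such closed subsets). Let $f\in A(K,(X,\tau))$ with $\|f\|=1$, and suppose that $\|f(t_0)\|_X=\|f\|$ for some limit point $t_0$ of $\Gamma$. Then $f$ is a Daugavet point of $A(K,(X,\tau))$: with $B$ the closed unit ball of $A(K,(X,\tau))$ and $\Delta_\varepsilon(f)=\{g\in B : \|f-g\|\ge 2-\varepsilon\}$, one has $$B=\overline{\operatorname{conv}}\,\Delta_\varepsilon(f)\qquad\text{for every }\varepsilon>0 .$$ -/

import Mathlib

open scoped ENNReal Topology

namespace FunctionSpace

universe u v

section Daugavet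

variable {V : Type*} [NormedAddCommGroup V]

/-- `Δ_ε(x)`: the points `y` of the closed unit ball with `‖x - y‖ ≥ 2 - ε`. -/
def deltaSet (ε : ℝ) (x : V) : Set V :=
  {y | ‖y‖ ≤ 1 ∧ 2 - ε ≤ ‖x - y‖}

/-- A point `x` of the unit sphere is a Daugavet point if the closed unit ball is the (norm) closed
convex hull of `Δ_ε(x)` for every `ε > 0`. -/
def IsDaugavetPoint [NormedSpace ℝ V] (x : V) : Prop :=
  ‖x‖ = 1 ∧ ∀ ε : ℝ, 0 < ε → Metric.closedBall (0 : V) 1 = closure (convexHull ℝ (deltaSet ε x))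

end Daugavet

section UniformAlgebra

variable {K : Type u} [TopologicalSpace K] [CompactSpace K]

/-- A uniform algebra on `K`: a sup-norm closed subalgebra of `C(K, ℂ)` that contains the constants
(part of `Subalgebra`) and separates the points of `K`. -/
structure IsUniformAlgebra (A : Subalgebra ℂ C(K, ℂ)) : Prop where
  isClosed : IsClosed (A : Set C(K, ℂ))
  separatesPoints : A.SeparatesPoints

/-- A subset `S` of `K` is a boundary for `A` if every element of `A` attains its norm on `S`. -/
def IsBoundary (A : Subalgebra ℂ C(K, ℂ)) (S : Set K) : Prop :=
  ∀ f ∈ A, ∃ t ∈ S, ‖f t‖ = ‖f‖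

/-- The Shilov boundary: the intersection of all closed boundaries. When there is a smallest closed
boundary (as is the case for uniform algebras on compact Hausdorff spaces), this is it. -/
def shilovBoundary (A : Subalgebra ℂ C(K, ℂ)) : Set K :=
  ⋂₀ {S | IsClosed S ∧ IsBoundary A S}

end UniformAlgebra

section Compatible

variable {X : Type v} [NormedAddCommGroup X] [NormedSpace ℂ X]

/-- `(X, τ)^* = X^*`: the `τ`-continuous linear functionals are the norm-continuous ones. -/
def DualEqDual (τ : TopologicalSpace X) : Prop :=
  ∀ φ : X →ₗ[ℂ] ℂ, Continuous[τ, _] φ ↔ Continuous[UniformSpace.toTopologicalSpace, _] φ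

/-- `(X, τ)^* = X_*` for some predual `X_*` of `X`: there are a Banach space `Y` and an isometric
isomorphism `J` of `X` onto the dual of `Y` such that the `τ`-continuous linear functionals
on `X` are exactly the evaluations at the elements of `Y`. (A predual embeds into the dual of `X`,
so asking that it lives in the universe of `X` is no restriction.) -/
def DualEqPredual (τ : TopologicalSpace X) : Prop :=
  ∃ (Y : Type v) (_ : NormedAddCommGroup Y) (_ : NormedSpace ℂ Y) (_ : CompleteSpace Y)
    (J : X ≃ₗᵢ[ℂ] StrongDual ℂ Y),
    ∀ φ : X →ₗ[ℂ] ℂ, Continuous[τ, _] φ ↔ ∃ y : Y, ∀ x : X, φ x = J x y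

/-- A locally convex Hausdorff vector space topology `τ` on the Banach space `X`, compatible to a
dual pair. -/
structure IsCompatible (τ : TopologicalSpace X) : Prop where
  isTopologicalAddGroup : @IsTopologicalAddGroup X τ _
  continuousSMul : @ContinuousSMul ℂ X _ _ τ
  locallyConvexSpace : @LocallyConvexSpace ℝ X _ _ _ _ τ
  t2Space : @T2Space X τ
  dual_eq : DualEqDual τ ∨ DualEqPredual τ

end Compatible

section Spaces

/-- A weakly bounded family is norm bounded. -/
theorem exists_bound_dual {K : Type u} {X : Type v} [NormedAddCommGroup X] [NormedSpace ℂ X]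
    (g : K → X) (key : ∀ φ : X →ₗ[ℂ] ℂ, Continuous φ → ∃ C, ∀ t : K, ‖φ (g t)‖ ≤ C) :
    BddAbove (Set.range fun t => ‖g t‖) := by
  obtain ⟨C, hC⟩ := banach_steinhaus (g := fun t => NormedSpace.inclusionInDoubleDual ℂ X (g t))
    (fun φ => by simpa using key φ.toLinearMap φ.continuous)
  refine ⟨C, ?_⟩
  rintro _ ⟨t, rfl⟩
  have := (NormedSpace.inclusionInDoubleDualLi ℂ (E := X)).norm_map (g t)
  exact this.symm.le.trans (hC t)

variable {K : Type u} [TopologicalSpace K] [CompactSpace K]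
  {X : Type v} [NormedAddCommGroup X] [NormedSpace ℂ X]

/-- Continuous functions from `K` to `(X, τ)` are norm bounded. -/
theorem memℓp_of_continuous {τ : TopologicalSpace X} (hτ : IsCompatible τ) {f : K → X}
    (hf : Continuous[_, τ] f) : Memℓp f ∞ := by
  rw [memℓp_infty_iff]
  rcases hτ.dual_eq with h | ⟨Y, _, _, _, J, h⟩
  · exact exists_bound_dual f fun φ hφ => by
      have hc : Continuous fun t => φ (f t) :=
        @Continuous.comp _ _ _ _ τ _ _ _ ((h φ).2 hφ) hf
      obtain ⟨C, hC⟩ := isCompact_univ.exists_bound_of_continuousOn hc.continuousOn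
      exact ⟨C, fun t => hC t trivial⟩
  · have key : ∀ y : Y, ∃ C, ∀ t : K, ‖J (f t) y‖ ≤ C := by
      intro y
      let φ : X →ₗ[ℂ] ℂ :=
        { toFun := fun x => J x y, map_add' := by simp, map_smul' := by simp }
      have hc : Continuous fun t => φ (f t) :=
        @Continuous.comp _ _ _ _ τ _ _ _ ((h φ).2 ⟨y, fun _ => rfl⟩) hf
      obtain ⟨C, hC⟩ := isCompact_univ.exists_bound_of_continuousOn hc.continuousOn
      exact ⟨C, fun t => hC t trivial⟩
    obtain ⟨C, hC⟩ := banach_steinhaus key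
    refine ⟨C, ?_⟩
    rintro _ ⟨t, rfl⟩
    simpa using hC t

/-- The space `C(K, (X, τ))` of all continuous functions from `K` to `(X, τ)` with the supremum
norm `‖f‖ = sup_t ‖f t‖`, as a subspace of the space of all bounded functions from `K` to `X`
(by `memℓp_of_continuous` boundedness excludes no continuous function). -/
def contSpace (K : Type u) [TopologicalSpace K] {τ : TopologicalSpace X} (hτ : IsCompatible τ) :
    Submodule ℂ (lp (fun _ : K => X) ∞) where
  carrier := {f | Continuous[_, τ] (fun t => f t)}
  add_mem' {f g} hf hg := by
    have h := hτ.isTopologicalAddGroup.toContinuousAdd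
    exact Continuous.add (M := X) hf hg
  zero_mem' := @continuous_const _ _ _ τ _
  smul_mem' c f hf := by
    have h := hτ.continuousSMul
    exact Continuous.smul (M := ℂ) (X := X) (continuous_const (y := c)) hf

/-- The set of all `y^* ∘ f` with `f ∈ S` and `y^* ∈ (X, τ)^*`. -/
def baseSet {τ : TopologicalSpace X} {hτ : IsCompatible τ} (S : Submodule ℂ (contSpace K hτ)) :
    Set C(K, ℂ) :=
  {φ | ∃ f ∈ S, ∃ y : X →ₗ[ℂ] ℂ, Continuous[τ, _] y ∧ ∀ t, φ t = y (f.1 t)}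

/-- `S` is an `(X, τ)`-valued function space over the uniform algebra `A` on `K`. -/
structure IsFunctionSpaceOver {τ : TopologicalSpace X} {hτ : IsCompatible τ}
    (S : Submodule ℂ (contSpace K hτ)) (A : Subalgebra ℂ C(K, ℂ)) : Prop where
  isClosed : IsClosed (S : Set (contSpace K hτ))
  base_eq : (A : Set C(K, ℂ)) = baseSet S
  isUniformAlgebra : IsUniformAlgebra A
  mul_mem : ∀ φ ∈ A, ∀ f ∈ S, ∃ g ∈ S, ∀ t, g.1 t = φ t • f.1 t

/-- `A ⊗ X`: the set of all functions `t ↦ φ(t) x` with `φ ∈ A` and `x ∈ X`. -/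
def tensorSet (A : Subalgebra ℂ C(K, ℂ)) (X : Type v) [NormedAddCommGroup X] [NormedSpace ℂ X] :
    Set (K → X) :=
  {g | ∃ φ ∈ A, ∃ x : X, ∀ t, g t = φ t • x}

/-- The elements of `S`, as a set of functions from `K` to `X`. -/
def functionSet {τ : TopologicalSpace X} {hτ : IsCompatible τ}
    (S : Submodule ℂ (contSpace K hτ)) : Set (K → X) :=
  {g | ∃ f ∈ S, ∀ t, g t = f.1 t}

end Spaces

end FunctionSpace

/-! Since `f` is only `τ`-continuous, `‖f‖` is merely lower semicontinuous, but this suffices for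
`‖f‖ > 1 - η` to hold on a neighbourhood of `t₀`. That neighbourhood contains as many points of the
Shilov boundary as desired, with disjoint neighbourhoods `U i`. In each of them there is a peak `h i
∈ A`: nearly `1` at some `p i`, small off `U i`, with values near `[0, 1]` (`exists_thin_peak`).
Given `g` in the unit ball, put `G i = (1 - h i) g - h i f(p i)`, which is in the space because it
contains `A ⊗ X`. Thinness of `h i` gives `‖G i‖ ≤ 1 + η`, and evaluation at `p i` puts `G i` almost
at distance `2` from `f` (`exists_far`). Since `g - G i = h i (g + f(p i))` and at each point at
most one `h i` fails to be small, the average of the `G i` tends to `g` as their number grows and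
`η` shrinks. -/

namespace FunctionSpace

universe w

open Filter Metric

/-! ### Holomorphic maps of the disc into thin neighbourhoods of `[0, 1]` -/

/-- The bound behind the thin lens: powers `w ^ α` with small exponent `α` of the points `w ≠ 0` in
the disc of radius `2` lie in a thin sector around the positive real axis. -/
theorem norm_one_sub_exp_add_norm_exp_le {α : ℝ} (h0 : 0 ≤ α) (h1 : α ≤ 1) {w : ℂ}
    (hw : ‖w‖ ≤ 2) :
    ‖1 - Complex.exp (α * Complex.log w)‖ + ‖Complex.exp (α * Complex.log w)‖ ≤ 1 + 16 * α := by
  set ρ : ℝ := Real.exp (α * Real.log ‖w‖) with hρ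
  have hρ0 : 0 < ρ := Real.exp_pos _
  have hlog : Real.log ‖w‖ ≤ 1 := by
    rcases (norm_nonneg w).eq_or_lt with h | h
    · simp [← h]
    · exact (Real.log_le_sub_one_of_pos h).trans (by linarith)
  have hρ1 : ρ ≤ 1 + 2 * α := by
    have h2 : ρ ≤ Real.exp α := Real.exp_le_exp.2 (by nlinarith)
    have h3 := Real.norm_exp_sub_one_sub_id_le (x := α) (by rwa [Real.norm_of_nonneg h0])
    rw [Real.norm_of_nonneg h0] at h3
    have h4 := (le_abs_self _).trans h3
    nlinarith
  have hu : Complex.exp (α * Complex.log w)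
      = ρ * Complex.exp (Complex.I * ((α * w.arg : ℝ) : ℂ)) := by
    rw [hρ, Complex.ofReal_exp, ← Complex.exp_add]
    congr 1
    rw [Complex.log]
    push_cast
    ring
  have hn : ‖Complex.exp (α * Complex.log w)‖ = ρ := by
    rw [hu, norm_mul, mul_comm Complex.I, Complex.norm_exp_ofReal_mul_I, mul_one,
      Complex.norm_real, Real.norm_of_nonneg hρ0.le]
  have hang : ‖Complex.exp (Complex.I * ((α * w.arg : ℝ) : ℂ)) - 1‖ ≤ 4 * α := by
    refine Real.norm_exp_I_mul_ofReal_sub_one_le.trans ?_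
    rw [Real.norm_eq_abs, abs_mul, abs_of_nonneg h0]
    nlinarith [Complex.abs_arg_le_pi w, Real.pi_le_four]
  have hsub : ‖1 - Complex.exp (α * Complex.log w)‖ ≤ |1 - ρ| + ρ * (4 * α) := by
    have : 1 - Complex.exp (α * Complex.log w) = ((1 - ρ : ℝ) : ℂ)
        - ρ * (Complex.exp (Complex.I * ((α * w.arg : ℝ) : ℂ)) - 1) := by
      rw [hu]; push_cast; ring
    rw [this]
    refine (norm_sub_le _ _).trans ?_
    rw [norm_mul, Complex.norm_real, Complex.norm_real, Real.norm_of_nonneg hρ0.le,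
      Real.norm_eq_abs]
    gcongr
  rw [hn]
  -- The angular error costs `12α`; if `ρ > 1`, then `|1 - ρ| + ρ = 2ρ - 1` costs another `4α`.
  have h5 : ρ * (4 * α) ≤ 3 * (4 * α) := by
    apply mul_le_mul_of_nonneg_right <;> linarith
  rcases abs_cases (1 - ρ) with h | h <;> linarith [h.1]

/-- A holomorphic map of a neighbourhood of the closed unit disc into a thin neighbourhood of
`[0, 1]` that fixes `0` and almost fixes `1`. -/
theorem exists_differentiableOn_thin {ε : ℝ} (hε : 0 < ε) :
    ∃ (R : NNReal) (F : ℂ → ℂ), 1 < R ∧ DifferentiableOn ℂ F (closedBall 0 R) ∧ F 0 = 0 ∧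
      (∀ z, ‖z‖ ≤ 1 → ‖F z‖ + ‖1 - F z‖ ≤ 1 + ε) ∧ ‖1 - F 1‖ ≤ ε := by
  obtain ⟨α, hα, hα1, hαε⟩ : ∃ α : ℝ, 0 < α ∧ α ≤ 1 ∧ 16 * α ≤ ε :=
    ⟨min 1 (ε / 16), by positivity, min_le_left _ _, by
      linarith [min_le_right 1 (ε / 16)]⟩
  -- The map is `F z = 1 - (1 - (1 - d) z) ^ α`. The bound on `d` says `d ^ α ≤ ε`, and `1 - F 1 = d
  -- ^ α`. With `R = 1 + d`, `(1 - d) R = 1 - d² < 1` keeps the logarithm off its branch cut.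
  obtain ⟨d, hd, hd1, hdε⟩ : ∃ d : ℝ, 0 < d ∧ d < 1 ∧ d ≤ Real.exp (Real.log ε / α) :=
    ⟨min (1 / 2) (Real.exp (Real.log ε / α)), by positivity,
      (min_le_left _ _).trans_lt (by norm_num), min_le_right _ _⟩
  obtain ⟨R, hR⟩ : ∃ R : NNReal, (R : ℝ) = 1 + d := ⟨⟨1 + d, by positivity⟩, rfl⟩
  refine ⟨R,
    fun z => 1 - Complex.exp (α * Complex.log (1 - (1 - d : ℝ) * z)), ?_, ?_, by simp, ?_, ?_⟩
  · rw [← NNReal.coe_lt_coe, hR, NNReal.coe_one]; linarith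
  · intro z hz
    have hz' : ‖z‖ ≤ 1 + d := by rwa [mem_closedBall_zero_iff, hR] at hz
    have hs : 1 - ((1 - d : ℝ) : ℂ) * z ∈ Complex.slitPlane := by
      rw [sub_eq_add_neg]
      apply Complex.mem_slitPlane_of_norm_lt_one
      rw [norm_neg, norm_mul, Complex.norm_real, Real.norm_of_nonneg (by linarith)]
      nlinarith
    apply DifferentiableAt.differentiableWithinAt
    have : DifferentiableAt ℂ (fun z : ℂ => 1 - ((1 - d : ℝ) : ℂ) * z) z := by fun_prop
    exact (((this.clog hs).const_mul (α : ℂ)).cexp).const_sub 1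
  · intro z hz
    have hw : ‖1 - ((1 - d : ℝ) : ℂ) * z‖ ≤ 2 := by
      refine (norm_sub_le _ _).trans ?_
      rw [norm_mul, Complex.norm_real, Real.norm_of_nonneg (by linarith), norm_one]
      nlinarith [norm_nonneg z]
    have := norm_one_sub_exp_add_norm_exp_le hα.le hα1 hw
    simp only [sub_sub_cancel]
    linarith
  · have h1 : (1 : ℂ) - ((1 - d : ℝ) : ℂ) * 1 = (d : ℂ) := by push_cast; ring
    simp only [sub_sub_cancel, h1]
    rw [← Complex.ofReal_log hd.le, ← Complex.ofReal_mul, Complex.norm_exp, Complex.ofReal_re,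
      ← Real.le_log_iff_exp_le hε]
    have := (Real.log_le_iff_le_exp hd).2 hdε
    rwa [le_div_iff₀ hα, mul_comm] at this

/-! ### Peaks at the Shilov boundary -/

section UniformAlgebra

variable {K : Type*} [TopologicalSpace K] [CompactSpace K] {A : Subalgebra ℂ C(K, ℂ)}

/-- A closed subalgebra of `C(K, ℂ)` is stable under composition with functions that are holomorphic
near the closed unit disc. -/
theorem exists_mem_eq_comp (hA : IsClosed (A : Set C(K, ℂ))) {φ : C(K, ℂ)} (hφ : φ ∈ A)
    (hφ1 : ‖φ‖ ≤ 1) {R : NNReal} (hR : 1 < R) {F : ℂ → ℂ}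
    (hF : DifferentiableOn ℂ F (closedBall 0 R)) : ∃ h ∈ A, ∀ t, h t = F (φ t) := by
  have hps := hF.hasFPowerSeriesOnBall (zero_lt_one.trans hR)
  -- The Taylor series converges uniformly only on balls smaller than `R`; one of radius `r > 1`
  -- still contains the range of `φ`.
  obtain ⟨r, hr1, hrR⟩ := exists_between hR
  have hlim := hps.tendstoUniformlyOn (r' := r) (by exact_mod_cast hrR)
  simp only [zero_add] at hlim
  have hmem : ∀ t, φ t ∈ ball (0 : ℂ) r := fun t => by
    rw [mem_ball_zero_iff]
    exact ((φ.norm_coe_le_norm t).trans hφ1).trans_lt (by exact_mod_cast hr1)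
  let h : C(K, ℂ) := ⟨fun t => F (φ t), hF.continuousOn.comp_continuous φ.continuous fun t =>
    closedBall_subset_closedBall (by exact_mod_cast hrR.le) (ball_subset_closedBall (hmem t))⟩
  refine ⟨h, ?_, fun t => rfl⟩
  let P : ℕ → C(K, ℂ) := fun n =>
    ∑ k ∈ Finset.range n, (cauchyPowerSeries F 0 R).coeff k • φ ^ k
  have hP : ∀ n, P n ∈ A := fun n =>
    A.sum_mem fun k _ => A.smul_mem (A.pow_mem hφ k) _
  have hPt : ∀ n t, P n t = (cauchyPowerSeries F 0 R).partialSum n (φ t) := fun n t => by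
    simp only [P, FormalMultilinearSeries.partialSum, ContinuousMap.sum_apply,
      ContinuousMap.smul_apply, ContinuousMap.pow_apply,
      FormalMultilinearSeries.apply_eq_pow_smul_coeff, smul_eq_mul, mul_comm]
  refine hA.mem_of_tendsto (f := P) (b := atTop) ?_ (Eventually.of_forall hP)
  rw [ContinuousMap.tendsto_iff_tendstoUniformly]
  rw [Metric.tendstoUniformlyOn_iff] at hlim
  rw [Metric.tendstoUniformly_iff]
  intro ε hε
  filter_upwards [hlim ε hε] with n hn t
  rw [hPt]
  exact hn (φ t) (hmem t)

/-- Near a point of the Shilov boundary there are elements of a closed subalgebra with norm `1` that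
take the value `1` and are small away from the point. -/
theorem exists_peak {t : K} (ht : t ∈ shilovBoundary A)
    {U : Set K} (hU : IsOpen U) (htU : t ∈ U) {δ : ℝ} (hδ : 0 < δ) :
    ∃ s ∈ U, ∃ φ ∈ A, ‖φ‖ ≤ 1 ∧ φ s = 1 ∧ ∀ x ∉ U, ‖φ x‖ ≤ δ := by
  -- Otherwise `Uᶜ` would be a closed boundary missing `t`. So some `φ ∈ A` attains its norm only
  -- inside `U`; normalising it and taking a high power gives the peak.
  have hnb : ¬ IsBoundary A Uᶜ := fun h => ht Uᶜ ⟨hU.isClosed_compl, h⟩ htU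
  simp only [IsBoundary, not_forall, not_exists, not_and] at hnb
  obtain ⟨φ, hφ, hne⟩ := hnb
  have hlt : ∀ x ∉ U, ‖φ x‖ < ‖φ‖ := fun x hx => lt_of_le_of_ne (φ.norm_coe_le_norm x) (hne x hx)
  have : Nonempty K := ⟨t⟩
  obtain ⟨s, -, hs⟩ := isCompact_univ.exists_isMaxOn Set.univ_nonempty
    (φ.continuous.norm.continuousOn)
  have hs' : ‖φ s‖ = ‖φ‖ := le_antisymm (φ.norm_coe_le_norm s)
    ((φ.norm_le (norm_nonneg _)).2 fun x => hs (Set.mem_univ x))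
  have hsU : s ∈ U := by
    by_contra h
    exact (hlt s h).ne hs'
  -- If `φ = 0`, the strict inequality off `U` forces `U` to be all of `K`, and the constant `1`
  -- serves.
  rcases eq_or_ne (φ s) 0 with h0 | h0
  · have huniv : ∀ x, x ∈ U := fun x => by
      by_contra h
      have := hlt x h
      rw [← hs', h0, norm_zero] at this
      exact (norm_nonneg _).not_gt this
    exact ⟨s, hsU, 1, A.one_mem, by simp, by simp, fun x hx => (hx (huniv x)).elim⟩
  let ψ : C(K, ℂ) := (φ s)⁻¹ • φ
  have hψ : ψ ∈ A := A.smul_mem hφ _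
  have hψv : ∀ x, ‖ψ x‖ = ‖φ x‖ / ‖φ‖ := fun x => by
    simp [ψ, hs', div_eq_inv_mul]
  have hpos : 0 < ‖φ‖ := by rw [← hs']; exact norm_pos_iff.2 h0
  have hψ1 : ∀ x, ‖ψ x‖ ≤ 1 := fun x => by
    rw [hψv, div_le_one hpos]; exact φ.norm_coe_le_norm x
  have hψlt : ∀ x ∉ U, ‖ψ x‖ < 1 := fun x hx => by
    rw [hψv, div_lt_one hpos]; exact hlt x hx
  obtain ⟨q, hq0, hq1, hq⟩ : ∃ q : ℝ, 0 ≤ q ∧ q < 1 ∧ ∀ x ∉ U, ‖ψ x‖ ≤ q := by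
    rcases (Uᶜ).eq_empty_or_nonempty with he | hne'
    · exact ⟨0, le_rfl, one_pos, fun x hx => (he.subset hx).elim⟩
    · obtain ⟨y, hy, hmax⟩ := hU.isClosed_compl.isCompact.exists_isMaxOn hne'
        (ψ.continuous.norm.continuousOn)
      exact ⟨‖ψ y‖, norm_nonneg _, hψlt y hy, fun x hx => hmax hx⟩
  obtain ⟨n, hn⟩ := exists_pow_lt_of_lt_one hδ hq1
  refine ⟨s, hsU, ψ ^ n, A.pow_mem hψ n, ?_, by simp [ψ, h0], fun x hx => ?_⟩
  · rw [ContinuousMap.norm_le _ zero_le_one]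
    intro x
    simpa using pow_le_one₀ (norm_nonneg _) (hψ1 x)
  · simpa using (pow_le_pow_left₀ (norm_nonneg _) (hq x hx) n).trans hn.le

/-- A Urysohn type lemma: near a point of the Shilov boundary there are elements of a closed
subalgebra that are almost `1` at some point, small away from it, and have values close to
`[0, 1]`. -/
theorem exists_thin_peak (hA : IsClosed (A : Set C(K, ℂ))) {t : K} (ht : t ∈ shilovBoundary A)
    {U : Set K} (hU : IsOpen U) (htU : t ∈ U) {ε : ℝ} (hε : 0 < ε) :
    ∃ s ∈ U, ∃ h ∈ A, ‖1 - h s‖ ≤ ε ∧ (∀ x, ‖h x‖ + ‖1 - h x‖ ≤ 1 + ε) ∧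
      ∀ x ∉ U, ‖h x‖ ≤ ε := by
  obtain ⟨R, F, hR, hF, hF0, hF1, hF2⟩ := exists_differentiableOn_thin hε
  -- Continuity at the fixed point `0` carries smallness of `φ` off `U` over to `F ∘ φ`.
  have hc : ContinuousAt F 0 := hF.continuousOn.continuousAt
    (closedBall_mem_nhds 0 (by exact_mod_cast zero_lt_one.trans hR))
  obtain ⟨δ, hδ, hδF⟩ := Metric.continuousAt_iff.1 hc ε hε
  obtain ⟨s, hsU, φ, hφ, hφ1, hφs, hφU⟩ := exists_peak ht hU htU (half_pos hδ)
  obtain ⟨h, hh, hval⟩ := exists_mem_eq_comp hA hφ hφ1 hR hF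
  refine ⟨s, hsU, h, hh, by rwa [hval, hφs],
    fun x => by rw [hval]; exact hF1 _ ((φ.norm_coe_le_norm x).trans hφ1), fun x hx => ?_⟩
  have := hδF (x := φ x) (by rw [dist_zero_right]; linarith [hφU x hx])
  rw [hF0, dist_zero_right] at this
  rw [hval]
  exact this.le

end UniformAlgebra

/-! ### Lower semicontinuity of the norm, and points of an accumulating set -/

/-- If `f` is weakly continuous, then `‖f‖` is lower semicontinuous. -/
theorem isClosed_setOf_norm_le_of_dual {K : Type*} [TopologicalSpace K]
    {X : Type*} [NormedAddCommGroup X] [NormedSpace ℂ X] {f : K → X} {c : ℝ} (hc : 0 ≤ c)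
    (hf : ∀ φ : X →ₗ[ℂ] ℂ, Continuous φ → Continuous fun t => φ (f t)) :
    IsClosed {t | ‖f t‖ ≤ c} := by
  have : {t | ‖f t‖ ≤ c} = ⋂ φ : StrongDual ℂ X, {t | ‖φ (f t)‖ ≤ c * ‖φ‖} := by
    ext t
    simp only [Set.mem_ofPred_eq, Set.mem_iInter]
    refine ⟨fun ht φ => (φ.le_opNorm _).trans ?_, NormedSpace.norm_le_dual_bound ℂ _ hc⟩
    rw [mul_comm]
    gcongr
  rw [this]
  exact isClosed_iInter fun φ =>
    isClosed_le (hf φ.toLinearMap φ.continuous).norm continuous_const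

/-- Closed balls around `0` in the norm are closed in a compatible topology. -/
theorem IsCompatible.isClosed_setOf_norm_le {K : Type*} [TopologicalSpace K]
    {X : Type*} [NormedAddCommGroup X] [NormedSpace ℂ X] {τ : TopologicalSpace X}
    (hτ : IsCompatible τ) {f : K → X} (hf : Continuous[_, τ] f) {c : ℝ} (hc : 0 ≤ c) :
    IsClosed {t | ‖f t‖ ≤ c} := by
  rcases hτ.dual_eq with h | ⟨Y, _, _, _, J, h⟩
  · exact isClosed_setOf_norm_le_of_dual hc fun φ hφ =>
      @Continuous.comp _ _ _ _ τ _ _ _ ((h φ).2 hφ) hf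
  -- Here only functionals from the predual are `τ`-continuous, but they already determine the norm
  -- of `J (f t)`.
  · have : {t | ‖f t‖ ≤ c} = ⋂ y : Y, {t | ‖J (f t) y‖ ≤ c * ‖y‖} := by
      ext t
      simp only [Set.mem_ofPred_eq, Set.mem_iInter]
      rw [← J.norm_map, ContinuousLinearMap.opNorm_le_iff hc]
    rw [this]
    refine isClosed_iInter fun y => isClosed_le (Continuous.norm ?_) continuous_const
    let φ : X →ₗ[ℂ] ℂ :=
      { toFun := fun x => J x y, map_add' := by simp, map_smul' := by simp }
    exact @Continuous.comp _ _ _ _ τ _ _ _ ((h φ).2 ⟨y, fun _ => rfl⟩) hf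

/-- A neighbourhood of an accumulation point of `C` contains `n` points of `C` with pairwise
disjoint neighbourhoods. -/
theorem exists_finset_disjoint_nhds_of_accPt {K : Type*} [TopologicalSpace K] [T2Space K]
    {C W : Set K} {t₀ : K} (h : AccPt t₀ (𝓟 C)) (hW : W ∈ 𝓝 t₀) (n : ℕ) :
    ∃ (s : Finset K) (U : K → Set K), s.card = n ∧ (s : Set K) ⊆ C ∩ W ∧
      (∀ x, x ∈ U x ∧ IsOpen (U x)) ∧ (s : Set K).PairwiseDisjoint U := by
  have hinf : (C ∩ W).Infinite := by
    intro hfin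
    have h1 := (accPt_iff_frequently.1 h).and_eventually hW
    -- A finite set is closed, so removing its points other than `t₀` would isolate `t₀` from `C`.
    have h2 : ((C ∩ W) \ {t₀})ᶜ ∈ 𝓝 t₀ :=
      (hfin.subset Set.sdiff_subset).isClosed.isOpen_compl.mem_nhds (by simp)
    obtain ⟨y, ⟨⟨hy, hyC⟩, hyW⟩, hy2⟩ := (h1.and_eventually h2).exists
    exact hy2 ⟨⟨hyC, hyW⟩, hy⟩
  obtain ⟨s, hs, hcard⟩ := hinf.exists_subset_card_eq n
  obtain ⟨U, hU, hd⟩ := s.finite_toSet.t2_separation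
  exact ⟨s, U, hcard, hs, hU, hd⟩

/-! ### Averaging criteria for Daugavet points -/

/-- A point of the unit sphere is a Daugavet point if every point of the unit ball is approximated
by averages of points of `Δ_ε(x)`. -/
theorem isDaugavetPoint_of_exists_average {V : Type*} [NormedAddCommGroup V] [NormedSpace ℝ V]
    {x : V} (hx : ‖x‖ = 1)
    (h : ∀ ε > 0, ∀ g : V, ‖g‖ ≤ 1 → ∃ (ι : Type w) (_ : Fintype ι) (_ : Nonempty ι) (y : ι → V),
      (∀ i, y i ∈ deltaSet ε x) ∧ ‖∑ i, (g - y i)‖ ≤ Fintype.card ι * ε) :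
    IsDaugavetPoint x := by
  refine ⟨hx, fun ε hε => Set.Subset.antisymm (fun g hg => ?_) ?_⟩
  · rw [mem_closedBall_zero_iff] at hg
    rw [Metric.mem_closure_iff]
    intro η hη
    -- The minimum with `ε` keeps the points in `Δ_ε(x)`; the minimum with `η / 2` makes the average
    -- strictly closer than `η`.
    obtain ⟨ι, _, _, y, hy, hyg⟩ := h (min ε (η / 2)) (by positivity) g hg
    have hn : (0 : ℝ) < Fintype.card ι := by exact_mod_cast Fintype.card_pos
    refine ⟨(Fintype.card ι : ℝ)⁻¹ • ∑ i, y i, ?_, ?_⟩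
    · rw [Finset.smul_sum]
      refine (convex_convexHull ℝ _).sum_mem (fun _ _ => by positivity) (by simp) fun i _ =>
        subset_convexHull ℝ _ ⟨(hy i).1, ?_⟩
      linarith [(hy i).2, min_le_left ε (η / 2)]
    · have : g - (Fintype.card ι : ℝ)⁻¹ • ∑ i, y i
          = (Fintype.card ι : ℝ)⁻¹ • ∑ i, (g - y i) := by
        rw [Finset.sum_sub_distrib, smul_sub, Finset.sum_const, Finset.card_univ,
          ← Nat.cast_smul_eq_nsmul ℝ, inv_smul_smul₀ hn.ne']
      rw [dist_eq_norm, this, norm_smul, Real.norm_of_nonneg (by positivity)]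
      calc (Fintype.card ι : ℝ)⁻¹ * ‖∑ i, (g - y i)‖
          ≤ (Fintype.card ι : ℝ)⁻¹ * (Fintype.card ι * min ε (η / 2)) := by gcongr
        _ = min ε (η / 2) := inv_mul_cancel_left₀ hn.ne' _
        _ < η := by linarith [min_le_right ε (η / 2)]
  · refine closure_minimal (convexHull_min (fun y hy => ?_) (convex_closedBall 0 1))
      isClosed_closedBall
    simpa using hy.1

/-- In `isDaugavetPoint_of_exists_average` it is enough that the points which are averaged lie almost
in the unit ball. -/
theorem isDaugavetPoint_of_exists_average_almost {V : Type*} [NormedAddCommGroup V]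
    [NormedSpace ℝ V] {x : V} (hx : ‖x‖ = 1)
    (h : ∀ ε > 0, ∀ g : V, ‖g‖ ≤ 1 → ∃ (ι : Type w) (_ : Fintype ι) (_ : Nonempty ι) (y : ι → V),
      (∀ i, ‖y i‖ ≤ 1 + ε ∧ 2 - ε ≤ ‖x - y i‖) ∧ ‖∑ i, (g - y i)‖ ≤ Fintype.card ι * ε) :
    IsDaugavetPoint x := by
  refine isDaugavetPoint_of_exists_average hx fun ε hε g hg => ?_
  -- The other half of `ε` pays for scaling by `c = 1 / (1 + ε / 2)`, which moves each point by at
  -- most `(1 - c)(1 + ε / 2) = ε / 2`.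
  obtain ⟨ι, _, _, G, hG, hGg⟩ := h (ε / 2) (half_pos hε) g hg
  obtain ⟨c, hc0, hc⟩ : ∃ c : ℝ, 0 < c ∧ c * (1 + ε / 2) = 1 :=
    ⟨(1 + ε / 2)⁻¹, by positivity, inv_mul_cancel₀ (by positivity)⟩
  have hGy : ∀ i, ‖G i - c • G i‖ ≤ ε / 2 := fun i => by
    have h1 : G i - c • G i = (1 - c) • G i := by rw [sub_smul, one_smul]
    rw [h1, norm_smul, Real.norm_of_nonneg (by nlinarith)]
    nlinarith [hG i]
  refine ⟨ι, inferInstance, inferInstance, fun i => c • G i, fun i => ⟨?_, ?_⟩, ?_⟩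
  · rw [norm_smul, Real.norm_of_nonneg hc0.le]
    nlinarith [hG i]
  · have h2 : ‖x - G i‖ ≤ ‖x - c • G i‖ + ‖G i - c • G i‖ := by
      rw [norm_sub_rev (G i)]
      exact (norm_add_le _ _).trans' (by simp)
    linarith [hG i, hGy i]
  · have hsplit : ∑ i, (g - c • G i) = ∑ i, (g - G i) + ∑ i, (G i - c • G i) := by
      rw [← Finset.sum_add_distrib]
      simp
    have hsum : ‖∑ i, (G i - c • G i)‖ ≤ Fintype.card ι * (ε / 2) := by
      refine (norm_sum_le_of_le _ fun i _ => hGy i).trans_eq ?_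
      rw [Finset.sum_const, Finset.card_univ, nsmul_eq_mul]
    rw [hsplit]
    linarith [norm_add_le (∑ i, (g - G i)) (∑ i, (G i - c • G i))]

/-- If all `a i` with `t ∉ U i` are at most `η`, where the sets `U i` are disjoint, then the sum of
the `a i` is at most the bound for a single one plus `η` for each index. -/
theorem sum_le_of_pairwiseDisjoint {K ι : Type*} [Fintype ι] {U : ι → Set K}
    (hU : Pairwise (Function.onFun Disjoint U)) {a : ι → ℝ} {η M : ℝ} (hη : 0 ≤ η) (hM : 0 ≤ M)
    (t : K) (haM : ∀ i, a i ≤ M) (ha : ∀ i, t ∉ U i → a i ≤ η) :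
    ∑ i, a i ≤ M + Fintype.card ι * η := by
  classical
  by_cases h : ∃ j, t ∈ U j
  · obtain ⟨j, hj⟩ := h
    calc ∑ i, a i ≤ ∑ i, ((if i = j then M else 0) + η) := by
          refine Finset.sum_le_sum fun i _ => ?_
          split_ifs with hij
          · linarith [haM i]
          · rw [zero_add]
            exact ha i fun hi => Set.disjoint_left.1 (hU hij) hi hj
      _ = M + Fintype.card ι * η := by simp [Finset.sum_add_distrib]
  · push Not at h
    calc ∑ i, a i ≤ ∑ _i : ι, η := Finset.sum_le_sum fun i _ => ha i (h i)
      _ ≤ M + Fintype.card ι * η := by simpa using hM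

/-! ### Perturbing `g` inside the function space -/

section FunctionSpaces

variable {K : Type*} [TopologicalSpace K]
  {X : Type*} [NormedAddCommGroup X] [NormedSpace ℂ X] {τ : TopologicalSpace X}
  {hτ : IsCompatible τ} {S : Submodule ℂ (contSpace K hτ)} {A : Subalgebra ℂ C(K, ℂ)}

/-- Evaluation at a point, as a linear map on a space of continuous functions. -/
def evalₗ (S : Submodule ℂ (contSpace K hτ)) (t : K) : S →ₗ[ℂ] X where
  toFun f := f.1.1 t
  map_add' _ _ := rfl
  map_smul' _ _ := rfl

theorem norm_evalₗ_le (t : K) (f : S) : ‖evalₗ S t f‖ ≤ ‖f‖ :=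
  lp.norm_apply_le_norm ENNReal.top_ne_zero f.1.1 t

theorem norm_le_of_forall_evalₗ {f : S} {C : ℝ} (hC : 0 ≤ C) (h : ∀ t, ‖evalₗ S t f‖ ≤ C) :
    ‖f‖ ≤ C :=
  lp.norm_le_of_forall_le hC h

/-- A function space over `A` that contains `A ⊗ X` contains `(1 - h) g - h x` for `h ∈ A`. -/
theorem IsFunctionSpaceOver.exists_evalₗ_eq (hS : IsFunctionSpaceOver S A)
    (hAX : tensorSet A X ⊆ functionSet S) (g : S) {h : C(K, ℂ)} (hh : h ∈ A) (x : X) :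
    ∃ G : S, ∀ t, evalₗ S t G = (1 - h t) • evalₗ S t g - h t • x := by
  obtain ⟨g₁, hg₁, hv₁⟩ := hS.mul_mem _ (A.sub_mem A.one_mem hh) g.1 g.2
  obtain ⟨g₂, hg₂, hv₂⟩ := hAX (a := fun t => h t • x) ⟨h, hh, x, fun _ => rfl⟩
  refine ⟨⟨g₁, hg₁⟩ - ⟨g₂, hg₂⟩, fun t => ?_⟩
  rw [map_sub]
  exact congrArg₂ (· - ·) (hv₁ t) (hv₂ t).symm

/-- The function `G = (1 - h) g - h f(p)` lies almost in the unit ball and has distance almost `2`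
from `f` if `h` is a thin peak at a point `p` where `f` almost attains its norm. -/
theorem IsFunctionSpaceOver.exists_far (hS : IsFunctionSpaceOver S A)
    (hAX : tensorSet A X ⊆ functionSet S) {f g : S} (hf : ‖f‖ ≤ 1) (hg : ‖g‖ ≤ 1) {η : ℝ}
    (hη : 0 < η) {h : C(K, ℂ)} (hh : h ∈ A) {p : K} (hp : 1 - η ≤ ‖evalₗ S p f‖)
    (hhp : ‖1 - h p‖ ≤ η) (hthin : ∀ t, ‖h t‖ + ‖1 - h t‖ ≤ 1 + η) :
    ∃ G : S, (∀ t, evalₗ S t G = (1 - h t) • evalₗ S t g - h t • evalₗ S p f) ∧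
      ‖G‖ ≤ 1 + η ∧ 2 - 4 * η ≤ ‖f - G‖ := by
  obtain ⟨G, hG⟩ := hS.exists_evalₗ_eq hAX g hh (evalₗ S p f)
  have hfp : ‖evalₗ S p f‖ ≤ 1 := (norm_evalₗ_le p f).trans hf
  have hgt : ∀ t, ‖evalₗ S t g‖ ≤ 1 := fun t => (norm_evalₗ_le t g).trans hg
  refine ⟨G, hG, norm_le_of_forall_evalₗ (by positivity) fun t => ?_, ?_⟩
  · rw [hG]
    refine (norm_sub_le _ _).trans ?_
    rw [norm_smul, norm_smul]
    linarith [hthin t, mul_le_of_le_one_right (norm_nonneg (1 - h t)) (hgt t),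
      mul_le_of_le_one_right (norm_nonneg (h t)) hfp]
  -- At `p` the difference is nearly `2 f(p)`: its norm is at least `2 (1 - η) - 2 η`.
  · have h1 : evalₗ S p (f - G) = (2 : ℂ) • evalₗ S p f
        - (1 - h p) • (evalₗ S p g + evalₗ S p f) := by
      rw [map_sub, hG]
      module
    have h2 : ‖(1 - h p) • (evalₗ S p g + evalₗ S p f)‖ ≤ η * 2 := by
      rw [norm_smul]
      gcongr
      linarith [norm_add_le (evalₗ S p g) (evalₗ S p f), hgt p]
    have h3 : ‖(2 : ℂ) • evalₗ S p f‖ = 2 * ‖evalₗ S p f‖ := by simp [norm_smul]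
    have h4 := norm_sub_norm_le ((2 : ℂ) • evalₗ S p f)
      ((1 - h p) • (evalₗ S p g + evalₗ S p f))
    rw [← h1] at h4
    linarith [norm_evalₗ_le p (f - G)]

end FunctionSpaces

end FunctionSpace

/-! ### The Daugavet point -/

theorem mainTheorem4 {K : Type*} [TopologicalSpace K] [CompactSpace K] [T2Space K]
    {X : Type*} [NormedAddCommGroup X] [NormedSpace ℂ X] [CompleteSpace X]
    (τ : TopologicalSpace X) (hτ : FunctionSpace.IsCompatible τ)
    (S : Submodule ℂ (FunctionSpace.contSpace K hτ)) (A : Subalgebra ℂ C(K, ℂ))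
    (hS : FunctionSpace.IsFunctionSpaceOver S A)
    (hAX : FunctionSpace.tensorSet A X ⊆ FunctionSpace.functionSet S)
    (f : S) (hf : ‖f‖ = 1)
    (t₀ : K) (ht₀ : AccPt t₀ (Filter.principal (FunctionSpace.shilovBoundary A)))
    (hft₀ : ‖f.1.1 t₀‖ = ‖f‖) :
    FunctionSpace.IsDaugavetPoint f := by
  open FunctionSpace in
  refine isDaugavetPoint_of_exists_average_almost hf fun ε hε g hg => ?_
  -- The factor `6` serves the last estimate: `n η > 1 ≥ η` gives `2 (1 + η + n η) ≤ 6 n η ≤ n ε`.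
  -- The distance bound needs only `4 η ≤ ε`.
  obtain ⟨η, hη, hη1, hηε⟩ : ∃ η : ℝ, 0 < η ∧ η ≤ 1 ∧ 6 * η ≤ ε :=
    ⟨min 1 (ε / 6), by positivity, min_le_left _ _, by linarith [min_le_right 1 (ε / 6)]⟩
  obtain ⟨n, hn⟩ := exists_nat_gt (1 / η)
  rw [div_lt_iff₀ hη] at hn
  have hW : IsOpen {t | 1 - η < ‖evalₗ S t f‖} := by
    have := (hτ.isClosed_setOf_norm_le f.1.2 (sub_nonneg.2 hη1)).isOpen_compl
    convert this using 1
    ext t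
    exact (not_le (α := ℝ)).symm
  have ht₀W : t₀ ∈ {t | 1 - η < ‖evalₗ S t f‖} := by
    change 1 - η < ‖f.1.1 t₀‖
    linarith
  obtain ⟨s, U, hcard, hs, hU, hd⟩ :=
    exists_finset_disjoint_nhds_of_accPt ht₀ (hW.mem_nhds ht₀W) n
  -- The peak point `p` need not be the chosen boundary point, so the neighbourhood is cut down to
  -- where `‖f‖ > 1 - η`.
  have hpeak : ∀ i : s, ∃ p ∈ U i ∩ {t | 1 - η < ‖evalₗ S t f‖}, ∃ h ∈ A, ‖1 - h p‖ ≤ η ∧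
      (∀ x, ‖h x‖ + ‖1 - h x‖ ≤ 1 + η) ∧ ∀ x ∉ U i ∩ {t | 1 - η < ‖evalₗ S t f‖}, ‖h x‖ ≤ η :=
    fun i => exists_thin_peak hS.isUniformAlgebra.isClosed (hs i.2).1 ((hU i).2.inter hW)
      ⟨(hU i).1, (hs i.2).2⟩ hη
  choose p hp h hhA hhp hthin hout using hpeak
  choose G hG hG1 hG2 using fun i : s => hS.exists_far hAX hf.le hg hη (hhA i) (hp i).2.le
    (hhp i) (hthin i)
  have hcard' : (Fintype.card s : ℝ) = n := by rw [Fintype.card_coe, hcard]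
  have hdisj : Pairwise (Function.onFun Disjoint fun i : s => U i) := fun i j hij =>
    hd i.2 j.2 (Subtype.coe_injective.ne hij)
  -- By disjointness only one summand can be large at a given `t`, so the bound is a constant plus
  -- `2 n η` instead of a multiple of `n`.
  have hsumG : ‖∑ i, (g - G i)‖ ≤ (1 + η + n * η) * 2 := by
    refine norm_le_of_forall_evalₗ (by positivity) fun t => ?_
    have hterm : ∀ i, ‖evalₗ S t (g - G i)‖ ≤ ‖h i t‖ * 2 := fun i => by
      have : evalₗ S t (g - G i) = h i t • (evalₗ S t g + evalₗ S (p i) f) := by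
        rw [map_sub, hG]
        module
      rw [this, norm_smul]
      gcongr
      linarith [norm_add_le (evalₗ S t g) (evalₗ S (p i) f), norm_evalₗ_le t g,
        norm_evalₗ_le (p i) f]
    rw [map_sum]
    refine (norm_sum_le_of_le _ fun i _ => hterm i).trans ?_
    rw [← Finset.sum_mul, ← hcard']
    gcongr
    exact sum_le_of_pairwiseDisjoint hdisj hη.le (by positivity) t
      (fun i => by linarith [hthin i t, norm_nonneg (1 - h i t)])
      (fun i hi => hout i t fun hi' => hi hi'.1)
  have hn0 : (0 : ℝ) < n := by
    by_contra h0
    nlinarith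
  refine ⟨s, inferInstance, ?_, G, fun i => ⟨?_, ?_⟩, hsumG.trans ?_⟩
  · rwa [← Fintype.card_pos_iff, ← Nat.cast_pos (α := ℝ), hcard']
  · linarith [hG1 i]
  · linarith [hG2 i]
  · rw [hcard']
    nlinarith
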